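/- Let $n\ge 3$ and let $G=(\mathbb{Z}/n\mathbb{Z},\omega)$, $\omega:\mathbb{Z}/n\mathbb{Z}\times\mathbb{Z}/n\mathbb{Z}\to[0,\infty]$, be a weighted cycle graph: $\omega(i,j)<\infty$ or $\omega(j,i)<\infty$ if and only if $i$ and $j$ are cyclically consecutive ($j=i+1$ or $i=j+1$ modulo $n$), and for consecutive $i,j$ exactly one of $\omega(i,j),\omega(j,i)$ is finite; this finite value is the weight of the edge between $i$ and $j$. Assume that $G$ is inconsistently oriented, i.e. the edges do not all point in the same direction around the cycle. For vertices $x,y$ let $d(x,y)\in[0,\infty]$ be the infimum of the weights $\sum_i\omega(p_i,p_{i+1})$ over all finite sequences of vertices $x=p_0,p_1,\dots,p_m=y$, $m\ge 0$ (so $d(x,x)=0$). For $\delta\in[0,\infty]$ let $\mathfrak{D}_\delta(G)$ be the Dowker source complex: the simplicial complex on the vertices of $G$ whose simplices are the nonempty sets $\sigma$ for which there is a vertex $y$ with $d(y,x)\le\delta$ for all $x\in\sigma$. A set $K$ of vertices is source dominating (for the path completion of $G$) if for every vertex $x$ there is $k\in K$ with $d(k,x)<\infty$, and minimal if no proper subset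 of it is source dominating. Suppose that $K=\{k_1,k_2\}$, with $k_1\neq k_2$, is a minimal source dominating set. Then $G$ has exactly two sinks (vertices without an outgoing edge of finite weight) $s_1\neq s_2$, and, with real coefficients, $H_1(\mathfrak{D}_\delta(G))$ is one-dimensional for all $\delta\in[0,\infty]$ with $$\max_i\ \min\{\omega(i,i+1),\omega(i+1,i)\}\ \le\ \delta\ <\ \max\{d(k_1,s_1),d(k_1,s_2),d(k_2,s_1),d(k_2,s_2)\},$$ the left-hand side being the largest edge weight of $G$, and $H_1(\mathfrak{D}_\delta(G))=0$ for every other $\delta\in[0,\infty]$. -/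

import Mathlib

open scoped ENNReal

noncomputable section

namespace Dowker

/-! ### Simplicial homology with real coefficients -/

section Homology

/-- The quotient `Z / B` of a submodule `Z` by a submodule `B ≤ Z` of the same real vector
space. -/
abbrev Subquotient {M : Type*} [AddCommGroup M] [Module ℝ M] (Z B : Submodule ℝ M) : Type _ :=
  Z ⧸ B.submoduleOf Z

variable {V : Type*} [LinearOrder V]

/-- The space of `k`-chains of `K`: formal real combinations of the faces of `K` with exactly
`k + 1` vertices. -/
def chains (K : PreAbstractSimplicialComplex V) (k : ℕ) : Submodule ℝ (Finset V →₀ ℝ) :=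
  Finsupp.supported ℝ ℝ {σ | σ ∈ K.faces ∧ σ.card = k + 1}

/-- The simplicial boundary map `[v₀ < ⋯ < v_k] ↦ ∑ᵢ (-1)ⁱ [v₀, …, v̂ᵢ, …, v_k]`. The position of a
vertex `v` in the simplex `σ` is the number of vertices of `σ` below `v`. The boundary of a
single vertex is zero (unreduced homology). -/
def boundary : (Finset V →₀ ℝ) →ₗ[ℝ] (Finset V →₀ ℝ) :=
  Finsupp.linearCombination ℝ fun σ : Finset V =>
    if 2 ≤ σ.card then
      ∑ v ∈ σ, Finsupp.single (σ.erase v) ((-1 : ℝ) ^ (σ.filter (· < v)).card)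
    else 0

/-- The `k`-cycles `ker ∂_k`. -/
def cycles (K : PreAbstractSimplicialComplex V) (k : ℕ) : Submodule ℝ (Finset V →₀ ℝ) :=
  chains K k ⊓ LinearMap.ker boundary

/-- The `k`-boundaries `im ∂_{k+1}`. -/
def boundaries (K : PreAbstractSimplicialComplex V) (k : ℕ) : Submodule ℝ (Finset V →₀ ℝ) :=
  (chains K (k + 1)).map boundary

/-- The `k`-th simplicial homology `H_k(K) = ker ∂_k / im ∂_{k+1}` with real coefficients. -/
abbrev Homology (K : PreAbstractSimplicialComplex V) (k : ℕ) : Type _ :=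
  Subquotient (cycles K k) (boundaries K k)

end Homology

/-! ### Weighted digraphs and Dowker complexes -/

section Network

variable {X : Type*}

/-- The shortest path function `d(x, y)` of the weighted digraph `(X, ω)`: the infimum of
`∑ ω(pᵢ, pᵢ₊₁)` over all finite sequences `x = p₀, p₁, …, p_m = y`, the constant path `m = 0`
having weight `0`. The weighted digraph `(X, d)` is the path completion of `(X, ω)`. -/
def pathDist (ω : X → X → ℝ≥0∞) (x y : X) : ℝ≥0∞ :=
  ⨅ (m : ℕ) (p : ℕ → X) (_ : p 0 = x) (_ : p m = y), ∑ i ∈ Finset.range m, ω (p i) (p (i + 1))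

/-- The Dowker complex of a relation `R` (`R y x` reads "`y` sees `x`"): a nonempty finite set of
vertices is a simplex if and only if some `y` sees all of its elements. -/
def dowkerOfRel {Y : Type*} (R : Y → X → Prop) : PreAbstractSimplicialComplex X where
  faces := {σ | σ.Nonempty ∧ ∃ y, ∀ x ∈ σ, R y x}
  isRelLowerSet_faces := by
    rintro σ ⟨hσ, y, hy⟩
    exact ⟨hσ, fun τ hτ hne => ⟨hne, y, fun x hx => hy x (hτ hx)⟩⟩

/-- The Dowker source complex `𝔇_δ(G)` of the weighted digraph `G = (X, ω)`, formed on the path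
completion of `G`. -/
def dowkerComplex (ω : X → X → ℝ≥0∞) (δ : ℝ≥0∞) : PreAbstractSimplicialComplex X :=
  dowkerOfRel fun y x => pathDist ω y x ≤ δ

/-- `K` is a source dominating set: every vertex is seen with finite weight by some element
of `K`. -/
def IsSourceDominating (ω : X → X → ℝ≥0∞) (K : Set X) : Prop :=
  ∀ x, ∃ k ∈ K, ω k x < ∞

/-- `s` is a sink: no edge of finite weight points out of `s`. -/
def IsSink (ω : X → X → ℝ≥0∞) (s : X) : Prop :=
  ∀ x, ω s x = ∞

end Network

/-! ### Weighted cycle graphs, on the vertex set `Fin n` with addition modulo `n` -/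

section Cycle

variable {n : ℕ} [NeZero n]

/-- `(Fin n, ω)` is a weighted cycle graph: finite weights occur exactly between cyclically
consecutive vertices, and there in exactly one of the two directions. -/
structure IsCycleGraph (ω : Fin n → Fin n → ℝ≥0∞) : Prop where
  three_le : 3 ≤ n
  finite_iff : ∀ i j, (ω i j < ∞ ∨ ω j i < ∞) ↔ (j = i + 1 ∨ i = j + 1)
  oriented : ∀ i j, ¬ (ω i j < ∞ ∧ ω j i < ∞)

/-- The edges do not all point in the same direction around the cycle. -/
def InconsistentlyOriented (ω : Fin n → Fin n → ℝ≥0∞) : Prop :=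
  ¬ (∀ i, ω i (i + 1) < ∞) ∧ ¬ (∀ i, ω (i + 1) i < ∞)

/-- The largest edge weight. The weight of the edge between `i` and `i + 1` is the one of
`ω i (i + 1)`, `ω (i + 1) i` that is finite. -/
def maxEdgeWeight (ω : Fin n → Fin n → ℝ≥0∞) : ℝ≥0∞ :=
  ⨆ i, min (ω i (i + 1)) (ω (i + 1) i)

end Cycle

end Dowker

end

noncomputable section

namespace Dowker

/-! ### Oriented edges, triangles and first homology -/

section OrientedEdges

variable {V : Type*} [LinearOrder V]

/-! By minimality neither `k₁` nor `k₂` reaches the other, which forces both to be sources, and the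
only ones (`IsCycleGraph.isSource_of_dominating`). Hence the cycle splits into four directed arcs,
one from each source to each of two sinks (`IsCycleGraph.exists_arcs`).

An edge of the complex seen by `y` can be coned off to `y`, and a cone edge can be pushed along a
shortest path. So modulo boundaries every 1-cycle lives on the edges of `G` of weight at most `δ`,
and is a multiple of the fundamental cycle, the zero multiple if some edge is heavier
(`exists_smul_fundamentalCycle`).

It remains to decide when the fundamental cycle bounds. If `δ` is finite and at least all four
source-sink distances, the cones at `k₁` and `k₂` fill it, glued along the sinks
(`fundamentalCycle_mem_boundaries_of_two`). If `δ` is below one of these distances, a cochain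
supported on that arc kills all boundaries but not the fundamental cycle
(`fundamentalCycle_not_mem_boundaries`). -/

/-- The oriented edge from `u` to `v` as a chain, antisymmetric in its endpoints. -/
def orientedEdge (u v : V) : Finset V →₀ ℝ :=
  if u < v then Finsupp.single {u, v} 1
  else if v < u then -Finsupp.single {u, v} 1 else 0

@[simp]
theorem orientedEdge_self (u : V) : orientedEdge u u = 0 := by
  simp [orientedEdge]

theorem orientedEdge_of_lt {u v : V} (h : u < v) :
    orientedEdge u v = Finsupp.single {u, v} 1 := by
  simp [orientedEdge, h]

theorem orientedEdge_swap (u v : V) : orientedEdge v u = -orientedEdge u v := by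
  rcases lt_trichotomy u v with h | rfl | h
  · simp [orientedEdge, h, h.not_gt, Finset.pair_comm v u]
  · simp
  · simp [orientedEdge, h, h.not_gt, Finset.pair_comm v u]

theorem boundary_single (σ : Finset V) :
    boundary (Finsupp.single σ 1) = if 2 ≤ σ.card then
      ∑ v ∈ σ, Finsupp.single (σ.erase v) ((-1 : ℝ) ^ (σ.filter (· < v)).card) else 0 := by
  simp [boundary]

theorem boundary_orientedEdge (u v : V) :
    boundary (orientedEdge u v) = Finsupp.single {v} 1 - Finsupp.single {u} 1 := by
  have key : ∀ u v : V, u < v →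
      boundary (orientedEdge u v) = Finsupp.single {v} 1 - Finsupp.single {u} 1 := by
    intro u v h
    rw [orientedEdge_of_lt h, boundary_single, if_pos (Finset.card_pair h.ne).ge,
      Finset.sum_pair h.ne]
    have e1 : ({u, v} : Finset V).erase u = {v} := by
      ext x; simp only [Finset.mem_erase, Finset.mem_insert, Finset.mem_singleton]; grind
    have e2 : ({u, v} : Finset V).erase v = {u} := by
      ext x; simp only [Finset.mem_erase, Finset.mem_insert, Finset.mem_singleton]; grind
    have f1 : ({u, v} : Finset V).filter (· < u) = ∅ := by
      ext x; simp only [Finset.mem_filter, Finset.mem_insert, Finset.mem_singleton]; grind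
    have f2 : ({u, v} : Finset V).filter (· < v) = {u} := by
      ext x; simp only [Finset.mem_filter, Finset.mem_insert, Finset.mem_singleton]; grind
    rw [e1, e2, f1, f2]
    simp [sub_eq_add_neg]
  rcases lt_trichotomy u v with h | rfl | h
  · exact key u v h
  · simp
  · rw [orientedEdge_swap, map_neg, key v u h, neg_sub]

theorem boundary_triangle {u v w : V} (huv : u < v) (hvw : v < w) :
    boundary (Finsupp.single {u, v, w} 1) =
      orientedEdge u v + orientedEdge v w + orientedEdge w u := by
  have huw := huv.trans hvw
  have e1 : ({u, v, w} : Finset V).erase u = {v, w} := by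
    ext x; simp only [Finset.mem_erase, Finset.mem_insert, Finset.mem_singleton]; grind
  have e2 : ({u, v, w} : Finset V).erase v = {u, w} := by
    ext x; simp only [Finset.mem_erase, Finset.mem_insert, Finset.mem_singleton]; grind
  have e3 : ({u, v, w} : Finset V).erase w = {u, v} := by
    ext x; simp only [Finset.mem_erase, Finset.mem_insert, Finset.mem_singleton]; grind
  have f1 : ({u, v, w} : Finset V).filter (· < u) = ∅ := by
    ext x; simp only [Finset.mem_filter, Finset.mem_insert, Finset.mem_singleton]; grind
  have f2 : ({u, v, w} : Finset V).filter (· < v) = {u} := by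
    ext x; simp only [Finset.mem_filter, Finset.mem_insert, Finset.mem_singleton]; grind
  have f3 : ({u, v, w} : Finset V).filter (· < w) = {u, v} := by
    ext x; simp only [Finset.mem_filter, Finset.mem_insert, Finset.mem_singleton]; grind
  have hc : ({u, v, w} : Finset V).card = 3 :=
    Finset.card_eq_three.2 ⟨u, v, w, huv.ne, huw.ne, hvw.ne, rfl⟩
  rw [boundary_single, if_pos (by omega), Finset.sum_insert (by simp [huv.ne, huw.ne]),
    Finset.sum_pair hvw.ne, e1, e2, e3, f1, f2, f3, Finset.card_pair huv.ne,
    orientedEdge_swap u w, orientedEdge_of_lt huv, orientedEdge_of_lt hvw, orientedEdge_of_lt huw]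
  simp
  abel

theorem exists_lt_lt_of_card_eq_three {σ : Finset V} (h : σ.card = 3) :
    ∃ u v w, u < v ∧ v < w ∧ σ = {u, v, w} := by
  obtain ⟨x, y, z, hxy, hxz, hyz, rfl⟩ := Finset.card_eq_three.1 h
  rcases lt_or_gt_of_ne hxy with h1 | h1 <;> rcases lt_or_gt_of_ne hxz with h2 | h2 <;>
    rcases lt_or_gt_of_ne hyz with h3 | h3
  · exact ⟨x, y, z, h1, h3, rfl⟩
  · exact ⟨x, z, y, h2, h3, by ext; simp; grind⟩
  · exact absurd (h1.trans h3) h2.not_gt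
  · exact ⟨z, x, y, h2, h1, by ext; simp; grind⟩
  · exact ⟨y, x, z, h1, h2, by ext; simp; grind⟩
  · exact absurd (h2.trans h3) h1.not_gt
  · exact ⟨y, z, x, h3, h2, by ext; simp; grind⟩
  · exact ⟨z, y, x, h3, h1, by ext; simp; grind⟩

theorem exists_lt_of_card_eq_two {σ : Finset V} (h : σ.card = 2) :
    ∃ u v, u < v ∧ σ = {u, v} := by
  obtain ⟨x, y, hxy, rfl⟩ := Finset.card_eq_two.1 h
  rcases lt_or_gt_of_ne hxy with h1 | h1
  · exact ⟨x, y, h1, rfl⟩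
  · exact ⟨y, x, h1, Finset.pair_comm x y⟩

variable {K : PreAbstractSimplicialComplex V}

/-- Antisymmetry makes the sum vanish for degenerate triples, so no distinctness or order is needed;
cone arguments rely on this. -/
theorem triangle_mem_boundaries {u v w : V} (h : {u, v, w} ∈ K.faces) :
    orientedEdge u v + orientedEdge v w + orientedEdge w u ∈ boundaries K 1 := by
  by_cases huv : u = v
  · subst huv; simp [orientedEdge_swap w u]
  by_cases hvw : v = w
  · subst hvw; simp [orientedEdge_swap v u]
  by_cases huw : u = w
  · subst huw; simp [orientedEdge_swap v u]
  have hc : ({u, v, w} : Finset V).card = 3 := Finset.card_eq_three.2 ⟨u, v, w, huv, huw, hvw, rfl⟩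
  have hmem : boundary (Finsupp.single {u, v, w} 1) ∈ boundaries K 1 :=
    Submodule.mem_map_of_mem (Finsupp.single_mem_supported ℝ _ ⟨h, hc⟩)
  have key : ∀ {x y z : V}, x < y → y < z → ({x, y, z} : Finset V) = {u, v, w} →
      orientedEdge x y + orientedEdge y z + orientedEdge z x ∈ boundaries K 1 := by
    intro x y z h1 h2 h3
    rwa [← boundary_triangle h1 h2, h3]
  rcases lt_or_gt_of_ne huv with h1 | h1 <;> rcases lt_or_gt_of_ne huw with h2 | h2 <;>
    rcases lt_or_gt_of_ne hvw with h3 | h3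
  · exact key h1 h3 rfl
  · rw [orientedEdge_swap v u, orientedEdge_swap w v, orientedEdge_swap u w]
    convert neg_mem (key h2 h3 (by ext; simp; grind)) using 1
    abel
  · exact absurd (h1.trans h3) h2.not_gt
  · convert key h2 h1 (by ext; simp; grind) using 1
    abel
  · rw [orientedEdge_swap v u, orientedEdge_swap w v, orientedEdge_swap u w]
    convert neg_mem (key h1 h2 (by ext; simp; grind)) using 1
    abel
  · exact absurd (h2.trans h3) h1.not_gt
  · convert key h3 h2 (by ext; simp; grind) using 1
    abel
  · rw [orientedEdge_swap v u, orientedEdge_swap w v, orientedEdge_swap u w]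
    convert neg_mem (key h3 h1 (by ext; simp; grind)) using 1
    abel

theorem chains_one_le {S : Submodule ℝ (Finset V →₀ ℝ)}
    (h : ∀ u v, {u, v} ∈ K.faces → orientedEdge u v ∈ S) : chains K 1 ≤ S := by
  rw [chains, Finsupp.supported_eq_span_single, Submodule.span_le]
  rintro _ ⟨σ, ⟨hσ, hc⟩, rfl⟩
  obtain ⟨u, v, huv, rfl⟩ := exists_lt_of_card_eq_two hc
  have := h u v hσ
  rwa [orientedEdge_of_lt huv] at this

theorem boundaries_one_le {S : Submodule ℝ (Finset V →₀ ℝ)}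
    (h : ∀ u v w, {u, v, w} ∈ K.faces →
      orientedEdge u v + orientedEdge v w + orientedEdge w u ∈ S) : boundaries K 1 ≤ S := by
  rw [boundaries, Submodule.map_le_iff_le_comap, chains, Finsupp.supported_eq_span_single,
    Submodule.span_le]
  rintro _ ⟨σ, ⟨hσ, hc⟩, rfl⟩
  obtain ⟨u, v, w, huv, hvw, rfl⟩ := exists_lt_lt_of_card_eq_three hc
  have := h u v w hσ
  rwa [← boundary_triangle huv hvw] at this

theorem boundaries_one_le_ker : boundaries K 1 ≤ LinearMap.ker boundary :=
  boundaries_one_le fun u v w _ => by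
    rw [LinearMap.mem_ker, map_add, map_add, boundary_orientedEdge, boundary_orientedEdge,
      boundary_orientedEdge]
    abel

theorem orientedEdge_mem_chains {u v : V} (h : {u, v} ∈ K.faces) :
    orientedEdge u v ∈ chains K 1 := by
  have key : u ≠ v → Finsupp.single {u, v} 1 ∈ chains K 1 := fun hne =>
    Finsupp.single_mem_supported ℝ _ ⟨h, Finset.card_pair hne⟩
  rcases lt_trichotomy u v with h1 | rfl | h1
  · rw [orientedEdge_of_lt h1]; exact key h1.ne
  · simp
  · rw [orientedEdge, if_neg h1.not_gt, if_pos h1]; exact neg_mem (key h1.ne')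

/-- The `1`-cochain with prescribed antisymmetric values on oriented edges. -/
theorem exists_cochain (f : V → V → ℝ) (hf : ∀ u v, f v u = -f u v) :
    ∃ ψ : (Finset V →₀ ℝ) →ₗ[ℝ] ℝ, ∀ u v, ψ (orientedEdge u v) = f u v := by
  set ψ : (Finset V →₀ ℝ) →ₗ[ℝ] ℝ := Finsupp.linearCombination ℝ
    fun σ : Finset V => ∑ u ∈ σ, ∑ v ∈ σ, if u < v then f u v else 0 with hψ
  have key : ∀ u v, u < v → ψ (orientedEdge u v) = f u v := by
    intro u v h
    rw [orientedEdge_of_lt h, hψ, Finsupp.linearCombination_single, one_smul,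
      Finset.sum_pair h.ne, Finset.sum_pair h.ne, Finset.sum_pair h.ne]
    simp [h, h.not_gt]
  refine ⟨ψ, fun u v => ?_⟩
  rcases lt_trichotomy u v with h | rfl | h
  · exact key u v h
  · have := hf u u
    rw [orientedEdge_self, map_zero]; linarith
  · rw [orientedEdge_swap, map_neg, key v u h, ← hf]

theorem subsingleton_homology_one (h : cycles K 1 ≤ boundaries K 1) :
    Subsingleton (Homology K 1) :=
  Submodule.Quotient.subsingleton_iff.2 (Submodule.submoduleOf_eq_top.2 h)

theorem finrank_homology_one {z : Finset V →₀ ℝ} (hz : z ∈ cycles K 1) (hz' : z ∉ boundaries K 1)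
    (h : ∀ c ∈ cycles K 1, ∃ r : ℝ, c - r • z ∈ boundaries K 1) :
    Module.finrank ℝ (Homology K 1) = 1 := by
  refine finrank_eq_one_iff'.2 ⟨Submodule.Quotient.mk ⟨z, hz⟩, ?_, ?_⟩
  · rw [Ne, Submodule.Quotient.mk_eq_zero]
    exact hz'
  · intro w
    obtain ⟨⟨c, hc⟩, rfl⟩ := Submodule.Quotient.mk_surjective _ w
    obtain ⟨r, hr⟩ := h c hc
    refine ⟨r, ?_⟩
    rw [← Submodule.Quotient.mk_smul]
    symm
    rw [Submodule.Quotient.eq]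
    exact hr

end OrientedEdges

/-! ### Shortest path distance and reachability -/

section PathDistance

variable {X : Type*} {ω : X → X → ℝ≥0∞}

theorem le_pathDist_iff {x y : X} {a : ℝ≥0∞} : a ≤ pathDist ω x y ↔ ∀ (m : ℕ) (p : ℕ → X),
    p 0 = x → p m = y → a ≤ ∑ i ∈ Finset.range m, ω (p i) (p (i + 1)) := by
  simp only [pathDist, le_iInf_iff]

theorem pathDist_le_sum (m : ℕ) (p : ℕ → X) :
    pathDist ω (p 0) (p m) ≤ ∑ i ∈ Finset.range m, ω (p i) (p (i + 1)) :=
  iInf_le_of_le m <| iInf_le_of_le p <| iInf_le_of_le rfl <| iInf_le_of_le rfl le_rfl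

@[simp]
theorem pathDist_self (x : X) : pathDist ω x x = 0 :=
  le_antisymm ((pathDist_le_sum 0 fun _ => x).trans (by simp)) bot_le

theorem pathDist_le_add (x y z : X) : pathDist ω x z ≤ pathDist ω x y + ω y z := by
  have hxy : pathDist ω x y + ω y z = ⨅ (m : ℕ) (p : ℕ → X) (_ : p 0 = x) (_ : p m = y),
      (∑ i ∈ Finset.range m, ω (p i) (p (i + 1)) + ω y z) := by
    simp only [pathDist, ENNReal.iInf_add]
  rw [hxy]
  refine le_iInf fun m => le_iInf fun p => le_iInf fun h0 => le_iInf fun hm => ?_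
  have h := pathDist_le_sum (ω := ω) (m + 1) (fun i => if i ≤ m then p i else z)
  rw [Finset.sum_range_succ] at h
  simp only [zero_le, if_true, le_refl, h0, hm, Nat.not_succ_le_self, if_false] at h
  refine h.trans (add_le_add (Finset.sum_le_sum fun i hi => ?_) le_rfl)
  have hi' := Finset.mem_range.1 hi
  simp [hi'.le, Nat.succ_le_of_lt hi']

theorem pathDist_le_weight (x y : X) : pathDist ω x y ≤ ω x y := by
  simpa using pathDist_le_add (ω := ω) x x y

/-- Finiteness of `X` lets the infimum over the last vertex before `z` be attained, so the distance
decomposes without a shortest path having to be produced. -/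
theorem exists_pathDist_add_le [Finite X] {x z : X} (h : x ≠ z) :
    ∃ y, pathDist ω x y + ω y z ≤ pathDist ω x z := by
  have : Nonempty X := ⟨x⟩
  obtain ⟨y, hy⟩ := exists_eq_ciInf_of_finite (f := fun y => pathDist ω x y + ω y z)
  refine ⟨y, ?_⟩
  rw [hy, le_pathDist_iff]
  intro m p h0 hm
  obtain _ | m := m
  · exact absurd (h0.symm.trans hm) h
  · rw [Finset.sum_range_succ, hm]
    refine (iInf_le _ (p m)).trans (add_le_add ?_ le_rfl)
    have := pathDist_le_sum (ω := ω) m p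
    rwa [h0] at this

/-- There is a directed path of finite weight from `x` to `y`. -/
def Reaches (ω : X → X → ℝ≥0∞) : X → X → Prop :=
  Relation.ReflTransGen fun x y => ω x y < ∞

theorem pathDist_lt_top_iff {x y : X} : pathDist ω x y < ∞ ↔ Reaches ω x y := by
  constructor
  · intro h
    simp only [pathDist, iInf_lt_iff] at h
    obtain ⟨m, p, rfl, rfl, h⟩ := h
    induction m with
    | zero => exact Relation.ReflTransGen.refl
    | succ m ih =>
      rw [Finset.sum_range_succ, ENNReal.add_lt_top] at h
      exact (ih h.1).tail h.2
  · intro h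
    induction h with
    | refl => simp
    | tail _ hbc ih =>
      exact (pathDist_le_add _ _ _).trans_lt (ENNReal.add_lt_top.2 ⟨ih, hbc⟩)

theorem Reaches.mem_of_closed {Q : Set X} (hQ : ∀ x ∈ Q, ∀ y, ω x y < ∞ → y ∈ Q) {x y : X}
    (h : Reaches ω x y) (hx : x ∈ Q) : y ∈ Q := by
  induction h with
  | refl => exact hx
  | tail _ hbc ih => exact hQ _ ih _ hbc

/-- If every vertex has at most one predecessor among the vertices that `k` reaches, then the
distance from `k` is bounded by its values at the sinks. -/
theorem pathDist_le_of_sinks [Finite X] {ρ : X → ℕ} {N : ℕ} (hρN : ∀ x, ρ x ≤ N)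
    (hρ : ∀ x y, ω x y < ∞ → ρ x < ρ y) {k : X} (hk : ∀ x, ω x k = ∞)
    (huniq : ∀ x y z, Reaches ω k x → Reaches ω k y → ω x z < ∞ → ω y z < ∞ → x = y)
    {δ : ℝ≥0∞} (hδ : ∀ s, IsSink ω s → pathDist ω k s ≤ δ) {x : X} (hx : Reaches ω k x) :
    pathDist ω k x ≤ δ := by
  induction hm : N - ρ x using Nat.strong_induction_on generalizing x with
  | _ m ih =>
    by_cases hs : IsSink ω x
    · exact hδ x hs
    · simp only [IsSink, not_forall, ← lt_top_iff_ne_top] at hs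
      obtain ⟨z, hz⟩ := hs
      -- Move on to a successor `z`, closer to a sink. The optimal last step into `z` must come from
      -- `x` by uniqueness of predecessors, so `x` is no farther from `k` than `z` is.
      have hz' : Reaches ω k z := hx.tail hz
      have hzδ : pathDist ω k z ≤ δ :=
        ih _ (by have := hρ x z hz; have := hρN z; omega) hz' rfl
      have hkz : k ≠ z := by
        rintro rfl
        exact hz.ne (hk x)
      obtain ⟨y, hy⟩ := exists_pathDist_add_le (ω := ω) hkz
      have hfin := ENNReal.add_lt_top.1 (hy.trans_lt (pathDist_lt_top_iff.2 hz'))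
      obtain rfl := huniq x y z hx (pathDist_lt_top_iff.1 hfin.1) hz hfin.2
      exact (le_self_add.trans hy).trans hzδ

end PathDistance

/-! ### Positions around the cycle -/

section CyclicPosition

variable {n : ℕ}

/-- The number of steps `i ↦ i + 1` that lead from `k` to `x`. -/
def offset (k x : Fin n) : ℕ := (x - k).val

theorem offset_lt (k x : Fin n) : offset k x < n := (x - k).isLt

variable [NeZero n]

@[simp]
theorem offset_self (k : Fin n) : offset k k = 0 := by
  simp [offset]

theorem offset_injective (k : Fin n) : Function.Injective (offset k) := fun _ _ h =>
  sub_left_injective (Fin.val_injective h)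

theorem exists_offset_eq (k : Fin n) {j : ℕ} (hj : j < n) : ∃ x, offset k x = j :=
  ⟨⟨j, hj⟩ + k, by simp [offset]⟩

theorem offset_add_one (h : 2 ≤ n) (k x : Fin n) :
    offset k (x + 1) = if offset k x + 1 = n then 0 else offset k x + 1 := by
  have hx := offset_lt k x
  unfold offset at *
  rw [show x + 1 - k = (x - k) + 1 by abel, Fin.val_add, Fin.val_one', Nat.mod_eq_of_lt h]
  split_ifs with h1
  · rw [h1, Nat.mod_self]
  · exact Nat.mod_eq_of_lt (by omega)

theorem forall_of_add_one {P : Fin n → Prop} {y : Fin n} (hy : P y) (h : ∀ i, P i → P (i + 1))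
    (x : Fin n) : P x := by
  by_cases hn : 2 ≤ n
  · induction hj : offset y x generalizing x with
    | zero => rwa [offset_injective y (hj.trans (offset_self y).symm)]
    | succ j ih =>
      have h1 := offset_add_one hn y (x - 1)
      rw [sub_add_cancel, hj] at h1
      have := h _ (ih (x - 1) (by split_ifs at h1; omega))
      rwa [sub_add_cancel] at this
  · have : Subsingleton (Fin n) := Fin.subsingleton_iff_le_one.2 (by omega)
    rwa [Subsingleton.elim x y]

end CyclicPosition

/-! ### Sources, sinks and directed arcs -/

section CycleStructure

variable {n : ℕ} [NeZero n] {ω : Fin n → Fin n → ℝ≥0∞}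

theorem IsCycleGraph.edge_iff (hc : IsCycleGraph ω) (x y : Fin n) :
    ω x y < ∞ ↔ (y = x + 1 ∧ ω x (x + 1) < ∞) ∨ (x = y + 1 ∧ ¬ ω y (y + 1) < ∞) := by
  constructor
  · intro h
    rcases (hc.finite_iff x y).1 (Or.inl h) with rfl | rfl
    · exact Or.inl ⟨rfl, h⟩
    · exact Or.inr ⟨rfl, fun h' => hc.oriented _ _ ⟨h, h'⟩⟩
  · rintro (⟨rfl, h⟩ | ⟨rfl, h⟩)
    · exact h
    · exact ((hc.finite_iff (y + 1) y).2 (Or.inr rfl)).resolve_right h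

theorem IsCycleGraph.weight_le_maxEdgeWeight (hc : IsCycleGraph ω) {x y : Fin n}
    (h : ω x y < ∞) : ω x y ≤ maxEdgeWeight ω := by
  have h' : ω y x = ∞ := by
    by_contra h2
    exact hc.oriented x y ⟨h, lt_top_iff_ne_top.2 h2⟩
  rcases (hc.finite_iff x y).1 (Or.inl h) with rfl | rfl
  · refine le_trans ?_ (le_iSup (fun i => min (ω i (i + 1)) (ω (i + 1) i)) x)
    simp [h']
  · refine le_trans ?_ (le_iSup (fun i => min (ω i (i + 1)) (ω (i + 1) i)) y)
    simp [h']

theorem IsCycleGraph.weight_self (hc : IsCycleGraph ω) (x : Fin n) : ω x x = ∞ := by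
  by_contra h
  exact hc.oriented x x ⟨lt_top_iff_ne_top.2 h, lt_top_iff_ne_top.2 h⟩

/-- A vertex that is needed for domination is a source. -/
theorem IsCycleGraph.isSource_of_dominating (hc : IsCycleGraph ω) {k k' : Fin n}
    (hdom : ∀ x, Reaches ω k x ∨ Reaches ω k' x) (hn : ¬ Reaches ω k' k) (x : Fin n) :
    ω x k = ∞ := by
  by_contra hx
  replace hx : ω x k < ∞ := lt_top_iff_ne_top.2 hx
  -- Suppose `k` has a predecessor. Then every vertex reaching `k` is also reached from it, hence
  -- has an edge in and an edge out. As it has only two neighbours, the orientation passes through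
  -- it, so the set of such vertices is closed under `+ 1` and contains `k'`.
  have hback : ∀ u, Reaches ω u k → Reaches ω k u := fun u hu =>
    (hdom u).resolve_right fun h => hn (h.trans hu)
  have hpred : ∀ u, Reaches ω u k → ∃ p, ω p u < ∞ := by
    intro u hu
    rcases Relation.ReflTransGen.cases_tail (hback u hu) with rfl | ⟨p, -, hp⟩
    · exact ⟨x, hx⟩
    · exact ⟨p, hp⟩
  have hsucc : ∀ u, Reaches ω u k → ∃ b, ω u b < ∞ ∧ Reaches ω b k := by
    intro u hu
    rcases Relation.ReflTransGen.cases_head hu with rfl | ⟨b, hb, hbk⟩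
    · have hux : Reaches ω u x := hback x (Relation.ReflTransGen.single hx)
      rcases Relation.ReflTransGen.cases_head hux with rfl | ⟨b, hb, hbk⟩
      · exact absurd (hc.weight_self u) hx.ne
      · exact ⟨b, hb, hbk.tail hx⟩
    · exact ⟨b, hb, hbk⟩
  refine hn (forall_of_add_one (P := fun u => Reaches ω u k) Relation.ReflTransGen.refl ?_ k')
  intro u hu
  obtain ⟨p, hp⟩ := hpred u hu
  obtain ⟨b, hb, hbk⟩ := hsucc u hu
  rcases (hc.finite_iff p u).1 (Or.inl hp) with rfl | rfl
  · rcases (hc.finite_iff (p + 1) b).1 (Or.inl hb) with rfl | h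
    · exact hbk
    · obtain rfl := add_left_injective 1 h
      exact absurd ⟨hp, hb⟩ (hc.oriented _ _)
  · exact Relation.ReflTransGen.head hp hu

theorem exists_switch {q : ℕ → Prop} {l r : ℕ} (hlr : l + 1 < r) (hl : q l) (hr : ¬ q (r - 1))
    (h : ∀ j, l ≤ j → j + 1 < r → q (j + 1) → q j) :
    ∃ a, l < a ∧ a < r ∧ ∀ j, l ≤ j → j < r → (q j ↔ j < a) := by
  classical
  have hex : ∃ j, l ≤ j ∧ ¬ q j := ⟨r - 1, by omega, hr⟩
  have hspec := Nat.find_spec hex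
  have hmin : ∀ j, l ≤ j → j < Nat.find hex → q j := fun j hj hlt => by
    by_contra hq
    exact Nat.find_min hex hlt ⟨hj, hq⟩
  have hle : Nat.find hex ≤ r - 1 := Nat.find_min' hex ⟨by omega, hr⟩
  refine ⟨Nat.find hex, lt_of_le_of_ne hspec.1 fun h0 => hspec.2 (h0 ▸ hl), by omega,
    fun j hlj hjr => ⟨fun hq => ?_, hmin j hlj⟩⟩
  by_contra hj
  rw [not_lt] at hj
  have : ∀ i, Nat.find hex ≤ i → i < r → ¬ q i := by
    intro i hi
    induction i, hi using Nat.le_induction with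
    | base => exact fun _ => hspec.2
    | succ i hi ih => exact fun hir hq => ih (by omega) (h i (hspec.1.trans hi) hir hq)
  exact this j hj hjr hq

theorem IsCycleGraph.isSource_add_one_iff (hc : IsCycleGraph ω) (x : Fin n) :
    (∀ y, ω y (x + 1) = ∞) ↔ ¬ ω x (x + 1) < ∞ ∧ ω (x + 1) (x + 1 + 1) < ∞ := by
  constructor
  · intro h
    refine ⟨(h x).not_lt, ?_⟩
    exact ((hc.finite_iff (x + 1) (x + 1 + 1)).2 (Or.inl rfl)).resolve_right (h _).not_lt
  · rintro ⟨h1, h2⟩ y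
    by_contra hy
    rcases (hc.edge_iff y (x + 1)).1 (lt_top_iff_ne_top.2 hy) with ⟨h, h'⟩ | ⟨rfl, h'⟩
    · rw [← add_left_injective 1 h] at h'
      exact h1 h'
    · exact h' h2

/-- A cycle graph with exactly two sources `k₁`, `k₂` consists of four directed arcs. In terms of
the offset from `k₁`, they are `[0, a]` and `[κ, a']`, directed upwards, and `[a, κ]` and
`[a', n]`, directed downwards. -/
theorem IsCycleGraph.exists_arcs (hc : IsCycleGraph ω) {k₁ k₂ : Fin n} (hne : k₁ ≠ k₂)
    (hsrc : ∀ x, (∀ y, ω y x = ∞) ↔ x = k₁ ∨ x = k₂) :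
    ∃ a a' : ℕ, 0 < a ∧ a < offset k₁ k₂ ∧ offset k₁ k₂ < a' ∧ a' < n ∧
      ∀ x y, ω x y < ∞ ↔
        (offset k₁ y = offset k₁ x + 1 ∧
          (offset k₁ x < a ∨ (offset k₁ k₂ ≤ offset k₁ x ∧ offset k₁ x < a'))) ∨
        (offset k₁ x = offset k₁ y + 1 ∧
          ((a ≤ offset k₁ y ∧ offset k₁ y < offset k₁ k₂) ∨ a' ≤ offset k₁ y)) ∨
        (offset k₁ x = 0 ∧ offset k₁ y + 1 = n) := by
  have hn := hc.three_le
  have hinj := offset_injective k₁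
  have hlt := offset_lt k₁
  have hadd := offset_add_one (by omega) k₁
  -- `q j` says that the edge leaving position `j` upwards is oriented upwards. Sources are the
  -- places where `q` changes from false to true, which happens only at positions `0` and `offset k₁
  -- k₂`. Between them `q` can only switch from true to false, once on each side.
  set q : ℕ → Prop := fun j => ∃ x, offset k₁ x = j ∧ ω x (x + 1) < ∞ with hq
  have hqx : ∀ x, q (offset k₁ x) ↔ ω x (x + 1) < ∞ := by
    intro x
    refine ⟨?_, fun h => ⟨x, rfl, h⟩⟩
    rintro ⟨y, hy, h⟩
    rwa [← hinj hy]
  have hstep : ∀ x, (¬ q (offset k₁ x) ∧ q (offset k₁ (x + 1))) ↔ x + 1 = k₁ ∨ x + 1 = k₂ := by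
    intro x
    rw [hqx, hqx, ← hc.isSource_add_one_iff, hsrc]
  have hk₂ : offset k₁ k₂ ≠ 0 := fun h => hne (hinj (by rw [h, offset_self]))
  have hup : ∀ j, j + 1 < n → ((¬ q j ∧ q (j + 1)) ↔ j + 1 = offset k₁ k₂) := by
    intro j hj
    obtain ⟨x, rfl⟩ := exists_offset_eq k₁ (show j < n by omega)
    have h1 := hadd x
    rw [if_neg hj.ne] at h1
    rw [← h1, hstep, hinj.eq_iff]
    constructor
    · rintro (h | h)
      · rw [h, offset_self] at h1
        omega
      · exact h
    · exact Or.inr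
  have hends : ¬ q (n - 1) ∧ q 0 := by
    obtain ⟨x, hx⟩ := exists_offset_eq k₁ (show n - 1 < n by omega)
    have h1 := hadd x
    rw [if_pos (by omega)] at h1
    rw [← hx, ← h1, hstep]
    exact Or.inl (hinj (by rw [h1, offset_self]))
  have hκ := hlt k₂
  have hκ' := (hup (offset k₁ k₂ - 1) (by omega)).2 (by omega)
  rw [Nat.sub_add_cancel (by omega)] at hκ'
  have hκ1 : offset k₁ k₂ ≠ 1 := fun h => by rw [h] at hκ'; exact hκ'.1 hends.2
  have hκn : offset k₁ k₂ ≠ n - 1 := fun h => by rw [h] at hκ'; exact hends.1 hκ'.2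
  have hno : ∀ j, j + 1 < n → j + 1 ≠ offset k₁ k₂ → q (j + 1) → q j := by
    intro j h1 h2 h3
    by_contra h4
    exact h2 ((hup j h1).1 ⟨h4, h3⟩)
  obtain ⟨a, ha0, haκ, ha⟩ := exists_switch (q := q) (l := 0) (r := offset k₁ k₂) (by omega)
    hends.2 hκ'.1 fun j _ h => hno j (by omega) (by omega)
  obtain ⟨a', ha0', haκ', ha'⟩ := exists_switch (q := q) (l := offset k₁ k₂) (r := n) (by omega)
    hκ'.2 hends.1 fun j _ h => hno j (by omega) (by omega)
  refine ⟨a, a', ha0, haκ, ha0', haκ', fun x y => ?_⟩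
  have horient : ∀ x, ω x (x + 1) < ∞ ↔
      offset k₁ x < a ∨ (offset k₁ k₂ ≤ offset k₁ x ∧ offset k₁ x < a') := by
    intro x
    rw [← hqx]
    rcases lt_or_ge (offset k₁ x) (offset k₁ k₂) with h | h
    · rw [ha _ (Nat.zero_le _) h]
      omega
    · rw [ha' _ h (hlt x)]
      omega
  rw [hc.edge_iff, horient, horient, ← hinj.eq_iff, ← hinj.eq_iff, hadd, hadd]
  have := hlt x
  have := hlt y
  split_ifs <;> omega

end CycleStructure

theorem mem_dowkerComplex_triple {X : Type*} [DecidableEq X] {ω : X → X → ℝ≥0∞} {δ : ℝ≥0∞}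
    {u v w : X} : {u, v, w} ∈ (dowkerComplex ω δ).faces ↔
      ∃ y, pathDist ω y u ≤ δ ∧ pathDist ω y v ≤ δ ∧ pathDist ω y w ≤ δ := by
  simp [dowkerComplex, dowkerOfRel]

theorem mem_dowkerComplex_pair {X : Type*} [DecidableEq X] {ω : X → X → ℝ≥0∞} {δ : ℝ≥0∞}
    {u v : X} : {u, v} ∈ (dowkerComplex ω δ).faces ↔
      ∃ y, pathDist ω y u ≤ δ ∧ pathDist ω y v ≤ δ := by
  simp [dowkerComplex, dowkerOfRel]

/-- Since `y` sees itself at distance `0`, it spans a simplex with any vertices it sees. -/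
theorem cone_mem_boundaries {X : Type*} [LinearOrder X] {ω : X → X → ℝ≥0∞}
    {δ : ℝ≥0∞} {y u v : X}
    (hu : pathDist ω y u ≤ δ) (hv : pathDist ω y v ≤ δ) :
    orientedEdge u v + orientedEdge y u - orientedEdge y v ∈
      boundaries (dowkerComplex ω δ) 1 := by
  have hy : pathDist ω y y ≤ δ := by simp
  have h := triangle_mem_boundaries (mem_dowkerComplex_triple.2 ⟨y, hy, hu, hv⟩)
  rw [orientedEdge_swap y v] at h
  convert h using 1
  abel

/-! ### The fundamental cycle in the Dowker complex -/

section CycleHomology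

variable {n : ℕ} [NeZero n] {ω : Fin n → Fin n → ℝ≥0∞} {δ : ℝ≥0∞}

/-- The fundamental cycle `∑ᵢ [i, i + 1]` of the cycle graph. -/
def fundamentalCycle (n : ℕ) [NeZero n] : Finset (Fin n) →₀ ℝ :=
  ∑ i : Fin n, orientedEdge i (i + 1)

/-- If `v` precedes `x` on a shortest path from `y`, then `y` sees both, so the edge from `y` to `x`
is homologous to the one to `v` followed by an edge of `G` of weight at most `δ`. The rank `ρ` makes
the recursion terminate. For `δ = ∞` seeing no longer implies reaching, but then one can simply walk
around the cycle. -/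
theorem orientedEdge_mem_of_reaches (hc : IsCycleGraph ω) {ρ : Fin n → ℕ}
    (hρ : ∀ x y, ω x y < ∞ → ρ x < ρ y) {S : Submodule ℝ (Finset (Fin n) →₀ ℝ)}
    (hB : boundaries (dowkerComplex ω δ) 1 ≤ S)
    (hS : ∀ i, min (ω i (i + 1)) (ω (i + 1) i) ≤ δ → orientedEdge i (i + 1) ∈ S)
    {y x : Fin n} (hx : pathDist ω y x ≤ δ) : orientedEdge y x ∈ S := by
  have hstep : ∀ v w, pathDist ω y v ≤ δ → pathDist ω y w ≤ δ → orientedEdge y v ∈ S →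
      orientedEdge v w ∈ S → orientedEdge y w ∈ S := by
    intro v w hv hw h1 h2
    have := sub_mem (add_mem h2 h1) (hB (cone_mem_boundaries hv hw))
    rwa [sub_sub_cancel] at this
  rcases eq_or_ne δ ∞ with rfl | hδ
  · exact forall_of_add_one (P := fun x => orientedEdge y x ∈ S) (y := y) (by simp)
      (fun i hi => hstep i (i + 1) le_top le_top hi (hS i le_top)) x
  · induction hm : ρ x using Nat.strong_induction_on generalizing x with
    | _ m ih =>
      rcases eq_or_ne y x with rfl | hyx
      · simp
      · obtain ⟨v, hv⟩ := exists_pathDist_add_le (ω := ω) hyx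
        have hvδ : pathDist ω y v ≤ δ := (le_self_add.trans hv).trans hx
        have hwδ : ω v x ≤ δ := (le_add_self.trans hv).trans hx
        have hfin : ω v x < ∞ := hwδ.trans_lt (lt_top_iff_ne_top.2 hδ)
        refine hstep v x hvδ hx (ih _ (hm ▸ hρ v x hfin) hvδ rfl) ?_
        rcases (hc.finite_iff v x).1 (Or.inl hfin) with rfl | rfl
        · exact hS v ((min_le_left _ _).trans hwδ)
        · rw [orientedEdge_swap x (x + 1)]
          exact neg_mem (hS x ((min_le_right _ _).trans hwδ))

theorem chains_dowkerComplex_le (hc : IsCycleGraph ω) {ρ : Fin n → ℕ}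
    (hρ : ∀ x y, ω x y < ∞ → ρ x < ρ y) {S : Submodule ℝ (Finset (Fin n) →₀ ℝ)}
    (hB : boundaries (dowkerComplex ω δ) 1 ≤ S)
    (hS : ∀ i, min (ω i (i + 1)) (ω (i + 1) i) ≤ δ → orientedEdge i (i + 1) ∈ S) :
    chains (dowkerComplex ω δ) 1 ≤ S := by
  refine chains_one_le fun u v h => ?_
  obtain ⟨y, hu, hv⟩ := mem_dowkerComplex_pair.1 h
  have h1 := hB (cone_mem_boundaries hu hv)
  have h2 := orientedEdge_mem_of_reaches hc hρ hB hS hu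
  have h3 := orientedEdge_mem_of_reaches hc hρ hB hS hv
  convert add_mem (sub_mem h1 h2) h3 using 1
  abel

/-- Every `1`-cycle is homologous to a multiple of the fundamental cycle, and to zero if some edge
has weight larger than `δ`. -/
theorem exists_smul_fundamentalCycle (hc : IsCycleGraph ω) {ρ : Fin n → ℕ}
    (hρ : ∀ x y, ω x y < ∞ → ρ x < ρ y) {c : Finset (Fin n) →₀ ℝ}
    (hcyc : c ∈ cycles (dowkerComplex ω δ) 1) :
    ∃ r : ℝ, c - r • fundamentalCycle n ∈ boundaries (dowkerComplex ω δ) 1 ∧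
      ∀ i, δ < min (ω i (i + 1)) (ω (i + 1) i) → r = 0 := by
  set Φ := Fintype.linearCombination ℝ fun i : Fin n => orientedEdge i (i + 1) with hΦ
  -- Edge coefficients vanishing on every edge heavier than `δ`.
  set A : Submodule ℝ (Fin n → ℝ) :=
    { carrier := {a | ∀ i, δ < min (ω i (i + 1)) (ω (i + 1) i) → a i = 0}
      add_mem' := fun {a b} ha hb i hi => by simp [ha i hi, hb i hi]
      zero_mem' := fun i _ => rfl
      smul_mem' := fun r a ha i hi => by simp [ha i hi] } with hA
  have hle : chains (dowkerComplex ω δ) 1 ≤ A.map Φ ⊔ boundaries (dowkerComplex ω δ) 1 := by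
    refine chains_dowkerComplex_le hc hρ le_sup_right fun i hi => ?_
    refine Submodule.mem_sup_left ⟨Pi.single i 1, fun j hj => ?_, ?_⟩
    · exact Pi.single_eq_of_ne (by rintro rfl; exact hi.not_gt hj) _
    · simp [hΦ]
  obtain ⟨_, ⟨a, ha, rfl⟩, b, hb, rfl⟩ := Submodule.mem_sup.1 (hle hcyc.1)
  have hker : boundary (Φ a) = 0 := by
    have h1 := LinearMap.mem_ker.1 hcyc.2
    rwa [map_add, LinearMap.mem_ker.1 (boundaries_one_le_ker hb), add_zero] at h1
  -- Reading off the boundary at the vertex `j + 1` compares the coefficients of its two edges.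
  have hstep : ∀ j, a (j + 1) = a j := by
    intro j
    have h1 := DFunLike.congr_fun hker {j + 1}
    rw [hΦ, Fintype.linearCombination_apply, map_sum] at h1
    simp only [map_smul, boundary_orientedEdge, Finsupp.coe_finsetSum, Finset.sum_apply,
      Finsupp.smul_apply, Finsupp.sub_apply, Finsupp.single_apply, Finset.singleton_inj,
      smul_eq_mul, mul_sub, Finset.sum_sub_distrib, add_left_inj, mul_ite, mul_one, mul_zero,
      Finset.sum_ite_eq', Finset.mem_univ, if_true, Finsupp.zero_apply] at h1
    linarith
  have hconst : ∀ j, a j = a 0 :=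
    forall_of_add_one (P := fun j => a j = a 0) rfl fun i hi => (hstep i).trans hi
  refine ⟨a 0, ?_, fun i hi => (hconst i).symm.trans (ha i hi)⟩
  have : Φ a = a 0 • fundamentalCycle n := by
    simp [hΦ, Fintype.linearCombination_apply, fundamentalCycle, Finset.smul_sum, hconst]
  rwa [this, add_sub_cancel_left]

/-- Modulo boundaries, `g` is a primitive of the edges of the cycle, so their sum telescopes to
zero. -/
theorem fundamentalCycle_mem_boundaries {K : PreAbstractSimplicialComplex (Fin n)}
    (g : Fin n → Finset (Fin n) →₀ ℝ)
    (hg : ∀ i, orientedEdge i (i + 1) + g i - g (i + 1) ∈ boundaries K 1) :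
    fundamentalCycle n ∈ boundaries K 1 := by
  have h1 : ∑ i, g (i + 1) = ∑ i, g i := Equiv.sum_comp (Equiv.addRight (1 : Fin n)) g
  have h2 := Submodule.sum_mem (boundaries K 1) (t := Finset.univ) fun i _ => hg i
  rwa [Finset.sum_sub_distrib, Finset.sum_add_distrib, h1, add_sub_cancel_right] at h2

theorem fundamentalCycle_mem_boundaries_top :
    fundamentalCycle n ∈ boundaries (dowkerComplex ω ∞) 1 := by
  exact fundamentalCycle_mem_boundaries (fun i => orientedEdge 0 i) fun i =>
    cone_mem_boundaries le_top le_top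

theorem fundamentalCycle_mem_boundaries_of_two {k₁ k₂ s₁ s₂ : Fin n}
    (h₁₁ : pathDist ω k₁ s₁ ≤ δ) (h₁₂ : pathDist ω k₁ s₂ ≤ δ)
    (h₂₁ : pathDist ω k₂ s₁ ≤ δ) (h₂₂ : pathDist ω k₂ s₂ ≤ δ)
    (hoverlap : ∀ x, pathDist ω k₁ x ≤ δ → pathDist ω k₂ x ≤ δ → x = s₁ ∨ x = s₂)
    (hedge : ∀ i, (pathDist ω k₁ i ≤ δ ∧ pathDist ω k₁ (i + 1) ≤ δ) ∨
      (pathDist ω k₂ i ≤ δ ∧ pathDist ω k₂ (i + 1) ≤ δ)) :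
    fundamentalCycle n ∈ boundaries (dowkerComplex ω δ) 1 := by
  classical
  -- The primitive is the cone at `k₁` where `k₁` sees, and otherwise the cone at `k₂` shifted by
  -- `c`. The shift makes both agree at `s₁`; at `s₂` they agree modulo boundaries, because both
  -- sources see the pair `s₁`, `s₂`.
  set c := orientedEdge k₁ s₁ - orientedEdge k₂ s₁ with hcdef
  set g : Fin n → Finset (Fin n) →₀ ℝ := fun x =>
    if pathDist ω k₁ x ≤ δ then orientedEdge k₁ x else orientedEdge k₂ x + c with hg
  have hg₁ : ∀ x, pathDist ω k₁ x ≤ δ → g x = orientedEdge k₁ x := fun x hx => if_pos hx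
  have hg₂ : ∀ x, pathDist ω k₂ x ≤ δ →
      g x - (orientedEdge k₂ x + c) ∈ boundaries (dowkerComplex ω δ) 1 := by
    intro x hx
    by_cases h : pathDist ω k₁ x ≤ δ
    · rw [hg₁ x h]
      rcases hoverlap x h hx with rfl | rfl
      · simp [hcdef]
      · convert sub_mem (cone_mem_boundaries h₂₁ h₂₂) (cone_mem_boundaries h₁₁ h₁₂) using 1
        rw [hcdef]
        abel
    · simp [hg, h]
  refine fundamentalCycle_mem_boundaries g fun i => ?_
  rcases hedge i with ⟨h1, h2⟩ | ⟨h1, h2⟩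
  · rw [hg₁ i h1, hg₁ _ h2]
    exact cone_mem_boundaries h1 h2
  · convert sub_mem (add_mem (cone_mem_boundaries h1 h2) (hg₂ i h1)) (hg₂ _ h2) using 1
    abel

/-- If an arc `P` leads from the source `k` (excluded) to the sink `s`, and `k` sees the first
vertex of the arc but not its last one, then the fundamental cycle is not a boundary. -/
theorem fundamentalCycle_not_mem_boundaries {P : Set (Fin n)} {k s p q : Fin n}
    (hs : IsSink ω s) (hk : ∀ x, ω x k = ∞)
    (hin : ∀ x ∈ P, ∀ y, ω x y < ∞ → y ∈ P)
    (hout : ∀ x ∉ P, x ≠ k → ∀ y, ω x y < ∞ → y ∈ P → y = s)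
    (hp : p ∈ P) (hq : q ∈ P) (hprev : ∀ j, j + 1 ∈ P → (j ∈ P ↔ j + 1 ≠ p))
    (hnext : ∀ j ∈ P, (j + 1 ∈ P ↔ j ≠ q))
    (hpq : (s = q ∧ pathDist ω k p ≤ δ) ∨ (s = p ∧ pathDist ω k q ≤ δ))
    (hδ : δ < pathDist ω k s) :
    fundamentalCycle n ∉ boundaries (dowkerComplex ω δ) 1 := by
  classical
  set C : Fin n → ℝ := fun x => if x ∈ P ∧ δ < pathDist ω k x then 1 else 0 with hC
  set I : Fin n → ℝ := fun x => if x ∈ P then 1 else 0 with hI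
  -- On a triangle seen by `y` one has `I = 1` if `y ∈ P`, `C = 0` if `y = k`, and `I = C`
  -- otherwise; each makes the cyclic sum vanish. On the fundamental cycle the value is `C q - C p`,
  -- which is nonzero since exactly one of the two ends is hidden from `k`.
  obtain ⟨ψ, hψ⟩ := exists_cochain (fun u v => I u * C v - I v * C u) fun u v => by ring
  have hker : boundaries (dowkerComplex ω δ) 1 ≤ LinearMap.ker ψ := by
    refine boundaries_one_le fun u v w h => ?_
    obtain ⟨y, hu, hv, hw⟩ := mem_dowkerComplex_triple.1 h
    have hreach : ∀ {x}, pathDist ω y x ≤ δ → Reaches ω y x := fun hx =>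
      pathDist_lt_top_iff.1 (hx.trans_lt (hδ.trans_le le_top))
    rw [LinearMap.mem_ker, map_add, map_add, hψ, hψ, hψ]
    by_cases hyP : y ∈ P
    · have hI1 : ∀ {x}, pathDist ω y x ≤ δ → I x = 1 := fun hx =>
        if_pos ((hreach hx).mem_of_closed hin hyP)
      rw [hI1 hu, hI1 hv, hI1 hw]
      ring
    · by_cases hyk : y = k
      · subst hyk
        have hC0 : ∀ {x}, pathDist ω y x ≤ δ → C x = 0 := fun hx =>
          if_neg fun h => h.2.not_ge hx
        rw [hC0 hu, hC0 hv, hC0 hw]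
        ring
      · have hQ : ∀ {x}, pathDist ω y x ≤ δ → I x = C x := by
          intro x hx
          -- A path from outside `P ∪ {k}` never meets the source `k`, so it can enter `P` only at
          -- `s`, where `C` equals `1`.
          have hx' : x ∈ {x | x ≠ k ∧ (x ∈ P → x = s)} := by
            refine (hreach hx).mem_of_closed ?_ ⟨hyk, fun h => absurd h hyP⟩
            rintro a ⟨hak, ha⟩ b hab
            refine ⟨?_, fun hb => ?_⟩
            · rintro rfl
              exact hab.ne (hk a)
            · by_cases haP : a ∈ P
              · rw [ha haP] at hab
                exact absurd (hs b) hab.ne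
              · exact hout a haP hak b hab hb
          by_cases hxP : x ∈ P
          · simp [hI, hC, hxP, hx'.2 hxP ▸ hδ]
          · simp [hI, hC, hxP]
        rw [hQ hu, hQ hv, hQ hw]
        ring
  intro hz
  have hz0 : ψ (fundamentalCycle n) = 0 := hker hz
  have h1 : ∀ i, I i * C (i + 1) = C (i + 1) - if i + 1 = p then C p else 0 := by
    intro i
    by_cases hi : i + 1 ∈ P
    · by_cases hip : i + 1 = p
      · simp [hI, hip, hprev i hi]
      · simp [hI, hip, hprev i hi]
    · have : C (i + 1) = 0 := if_neg fun h => hi h.1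
      rw [this, if_neg (by rintro rfl; exact hi hp)]
      ring
  have h2 : ∀ i, I (i + 1) * C i = C i - if i = q then C q else 0 := by
    intro i
    by_cases hi : i ∈ P
    · by_cases hiq : i = q
      · subst hiq
        simp [hI, hnext i hi]
      · simp [hI, hiq, hnext i hi]
    · have : C i = 0 := if_neg fun h => hi h.1
      rw [this, if_neg (by rintro rfl; exact hi hq)]
      ring
  have h3 : ∑ i, C (i + 1) = ∑ i, C i := Equiv.sum_comp (Equiv.addRight (1 : Fin n)) C
  have h4 : (∑ i : Fin n, if i + 1 = p then C p else 0) = C p := by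
    exact (Equiv.sum_comp (Equiv.addRight (1 : Fin n)) (fun i => if i = p then C p else 0)).trans
      (by simp)
  rw [fundamentalCycle, map_sum] at hz0
  simp only [hψ, h1, h2, Finset.sum_sub_distrib, h3, h4, Finset.sum_ite_eq', Finset.mem_univ,
    if_true] at hz0
  rcases hpq with ⟨rfl, h⟩ | ⟨rfl, h⟩
  · have e1 : C s = 1 := if_pos ⟨hq, hδ⟩
    have e2 : C p = 0 := if_neg fun h' => h'.2.not_ge h
    linarith
  · have e1 : C s = 1 := if_pos ⟨hp, hδ⟩
    have e2 : C q = 0 := if_neg fun h' => h'.2.not_ge h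
    linarith

theorem orientedEdge_mem_chains_of_weight_le {i : Fin n}
    (h : min (ω i (i + 1)) (ω (i + 1) i) ≤ δ) :
    orientedEdge i (i + 1) ∈ chains (dowkerComplex ω δ) 1 := by
  refine orientedEdge_mem_chains (mem_dowkerComplex_pair.2 ?_)
  rcases min_le_iff.1 h with h | h
  · exact ⟨i, by simp, (pathDist_le_weight _ _).trans h⟩
  · exact ⟨i + 1, (pathDist_le_weight _ _).trans h, by simp⟩

theorem fundamentalCycle_mem_cycles (h : maxEdgeWeight ω ≤ δ) :
    fundamentalCycle n ∈ cycles (dowkerComplex ω δ) 1 := by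
  refine ⟨Submodule.sum_mem _ fun i _ => orientedEdge_mem_chains_of_weight_le
    ((le_iSup (fun i => min (ω i (i + 1)) (ω (i + 1) i)) i).trans h), ?_⟩
  rw [SetLike.mem_coe, LinearMap.mem_ker, fundamentalCycle, map_sum]
  simp only [boundary_orientedEdge, Finset.sum_sub_distrib]
  rw [sub_eq_zero]
  exact Equiv.sum_comp (Equiv.addRight (1 : Fin n)) fun i => Finsupp.single ({i} : Finset (Fin n)) (1 : ℝ)

end CycleHomology

end Dowker

end

/-! ### The homology for each `δ` -/

theorem mainTheorem6 (n : ℕ) [NeZero n] (ω : Fin n → Fin n → ℝ≥0∞)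
    (hcycle : Dowker.IsCycleGraph ω) (horient : Dowker.InconsistentlyOriented ω)
    (k₁ k₂ : Fin n) (hne : k₁ ≠ k₂)
    (hK : Minimal (Dowker.IsSourceDominating (Dowker.pathDist ω)) {k₁, k₂}) :
    ∃ s₁ s₂ : Fin n, s₁ ≠ s₂ ∧ {s | Dowker.IsSink ω s} = {s₁, s₂} ∧
      ∀ δ : ℝ≥0∞,
        ((Dowker.maxEdgeWeight ω ≤ δ ∧
            δ < max (max (Dowker.pathDist ω k₁ s₁) (Dowker.pathDist ω k₁ s₂))
              (max (Dowker.pathDist ω k₂ s₁) (Dowker.pathDist ω k₂ s₂))) →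
          Module.finrank ℝ (Dowker.Homology (Dowker.dowkerComplex ω δ) 1) = 1) ∧
        (¬ (Dowker.maxEdgeWeight ω ≤ δ ∧
            δ < max (max (Dowker.pathDist ω k₁ s₁) (Dowker.pathDist ω k₁ s₂))
              (max (Dowker.pathDist ω k₂ s₁) (Dowker.pathDist ω k₂ s₂))) →
          Subsingleton (Dowker.Homology (Dowker.dowkerComplex ω δ) 1)) := by
  open Dowker in
  -- the elements of the dominating set are exactly the sources
  have hdom : ∀ x, Reaches ω k₁ x ∨ Reaches ω k₂ x := by
    intro x
    obtain ⟨k, rfl | rfl, hx⟩ := hK.1 x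
    · exact Or.inl (pathDist_lt_top_iff.1 hx)
    · exact Or.inr (pathDist_lt_top_iff.1 hx)
  have hn₁₂ : ¬ Reaches ω k₁ k₂ := by
    intro h
    have h1 : IsSourceDominating (pathDist ω) {k₁} := fun x =>
      ⟨k₁, rfl, pathDist_lt_top_iff.2 ((hdom x).elim id h.trans)⟩
    exact hne (hK.2 h1 (by simp) (Or.inr rfl : k₂ ∈ ({k₁, k₂} : Set (Fin n)))).symm
  have hn₂₁ : ¬ Reaches ω k₂ k₁ := by
    intro h
    have h1 : IsSourceDominating (pathDist ω) {k₂} := fun x =>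
      ⟨k₂, rfl, pathDist_lt_top_iff.2 ((hdom x).elim h.trans id)⟩
    exact hne (hK.2 h1 (by simp) (Or.inl rfl : k₁ ∈ ({k₁, k₂} : Set (Fin n))))
  have hk₁ := hcycle.isSource_of_dominating hdom hn₂₁
  have hk₂ := hcycle.isSource_of_dominating (fun x => (hdom x).symm) hn₁₂
  have hsrc : ∀ x, (∀ y, ω y x = ∞) ↔ x = k₁ ∨ x = k₂ := by
    refine fun x => ⟨fun h => ?_, ?_⟩
    · have key : ∀ k, Reaches ω k x → x = k := by
        intro k hk
        rcases Relation.ReflTransGen.cases_tail hk with h' | ⟨b, -, hb⟩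
        · exact h'
        · exact absurd (h b) hb.ne
      exact (hdom x).imp (key _) (key _)
    · rintro (rfl | rfl)
      · exact hk₁
      · exact hk₂
  -- the four arcs
  obtain ⟨a, a', ha, haκ, haκ', ha', hE⟩ := hcycle.exists_arcs hne hsrc
  have hn3 := hcycle.three_le
  have hinj := offset_injective k₁
  have h0 : offset k₁ k₁ = 0 := offset_self k₁
  have hlt := offset_lt k₁
  have hadd := offset_add_one (by omega) k₁
  have hex := fun j (hj : j < n) => exists_offset_eq k₁ hj
  generalize hκ : offset k₁ k₂ = κ at haκ haκ' hE
  generalize offset k₁ = pos at *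
  obtain ⟨s₁, hs₁⟩ := hex a (by omega)
  obtain ⟨s₂, hs₂⟩ := hex a' (by omega)
  have hsink : ∀ s, IsSink ω s ↔ s = s₁ ∨ s = s₂ := by
    intro s
    rw [← hinj.eq_iff, ← hinj.eq_iff, hs₁, hs₂]
    have hs := hlt s
    constructor
    · intro h
      have hE' : ∀ y, ¬ ω s y < ∞ := fun y => (h y).not_lt
      by_contra hne'
      by_cases hup : pos s < a ∨ (κ ≤ pos s ∧ pos s < a')
      · obtain ⟨y, hy⟩ := hex (pos s + 1) (by omega)
        have := hE' y
        rw [hE] at this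
        omega
      · obtain ⟨y, hy⟩ := hex (pos s - 1) (by omega)
        have := hE' y
        rw [hE] at this
        omega
    · intro h y
      by_contra hy
      have := (hE s y).1 (lt_top_iff_ne_top.2 hy)
      omega
  -- Off the sinks, the number of steps from the source of the arc; at the sinks `n`, which exceeds
  -- every arc position and so serves both incoming arcs.
  set ρ : Fin n → ℕ := fun x =>
    if pos x = a ∨ pos x = a' then n else if pos x < a then pos x else
      if pos x ≤ κ then κ - pos x else if pos x < a' then pos x - κ else n - pos x with hρdef
  have hρ : ∀ x y, ω x y < ∞ → ρ x < ρ y := by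
    intro x y h
    have h1 := (hE x y).1 h
    have h2 := hlt x
    have h3 := hlt y
    simp only [hρdef]
    split_ifs <;> omega
  have hρn : ∀ x, ρ x ≤ n := by
    intro x
    have h2 := hlt x
    simp only [hρdef]
    split_ifs <;> omega
  have hR₁ : ∀ x, Reaches ω k₁ x → pos x ≤ a ∨ a' ≤ pos x := by
    intro x hx
    refine hx.mem_of_closed (Q := {x | pos x ≤ a ∨ a' ≤ pos x}) ?_ (Or.inl (by omega))
    intro x hx y h
    have h1 := (hE x y).1 h
    simp only [Set.mem_ofPred_eq] at hx ⊢
    omega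
  have hR₂ : ∀ x, Reaches ω k₂ x → a ≤ pos x ∧ pos x ≤ a' := by
    intro x hx
    refine hx.mem_of_closed (Q := {x | a ≤ pos x ∧ pos x ≤ a'}) ?_ ⟨by omega, by omega⟩
    intro x hx y h
    have h1 := (hE x y).1 h
    simp only [Set.mem_ofPred_eq] at hx ⊢
    omega
  refine ⟨s₁, s₂, fun h => by rw [h] at hs₁; omega, by ext s; exact hsink s, fun δ => ?_⟩
  have hweight : ∀ {x y}, ω x y < ∞ → maxEdgeWeight ω ≤ δ → pathDist ω x y ≤ δ := fun h hδ =>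
    (pathDist_le_weight _ _).trans ((hcycle.weight_le_maxEdgeWeight h).trans hδ)
  constructor
  · rintro ⟨hm, hM⟩
    refine finrank_homology_one (fundamentalCycle_mem_cycles hm) ?_ fun c hc =>
      (exists_smul_fundamentalCycle hcycle hρ hc).imp fun r hr => hr.1
    -- One case per arc. Each time `P` is the arc without its source; one end is the sink, and the
    -- other is adjacent to the source, hence seen because `δ` bounds every edge weight.
    rcases lt_max_iff.1 hM with h | h <;> rcases lt_max_iff.1 h with h | h
    · obtain ⟨p, hp⟩ := hex 1 (by omega)
      refine fundamentalCycle_not_mem_boundaries (P := {x | 1 ≤ pos x ∧ pos x ≤ a}) (p := p)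
        (q := s₁) ((hsink _).2 (Or.inl rfl)) hk₁ ?_ ?_ ?_ ?_ ?_ ?_
        (Or.inl ⟨rfl, hweight ((hE _ _).2 (by omega)) hm⟩) h
      all_goals simp only [Set.mem_ofPred_eq, ne_eq, ← hinj.eq_iff, hadd]
      · intro x hx y hy
        have := (hE x y).1 hy
        omega
      · intro x hx hxk y hy
        have := (hE x y).1 hy
        have := hlt x
        omega
      · omega
      · omega
      · intro j
        have := hlt j
        split_ifs <;> omega
      · intro j
        have := hlt j
        split_ifs <;> omega
    · obtain ⟨q, hq⟩ := hex (n - 1) (by omega)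
      refine fundamentalCycle_not_mem_boundaries (P := {x | a' ≤ pos x}) (p := s₂)
        (q := q) ((hsink _).2 (Or.inr rfl)) hk₁ ?_ ?_ ?_ ?_ ?_ ?_
        (Or.inr ⟨rfl, hweight ((hE _ _).2 (by omega)) hm⟩) h
      all_goals simp only [Set.mem_ofPred_eq, ne_eq, ← hinj.eq_iff, hadd]
      · intro x hx y hy
        have := (hE x y).1 hy
        omega
      · intro x hx hxk y hy
        have := (hE x y).1 hy
        have := hlt x
        omega
      · omega
      · omega
      · intro j
        have := hlt j
        split_ifs <;> omega
      · intro j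
        have := hlt j
        split_ifs <;> omega
    · obtain ⟨q, hq⟩ := hex (κ - 1) (by omega)
      refine fundamentalCycle_not_mem_boundaries (P := {x | a ≤ pos x ∧ pos x < κ}) (p := s₁)
        (q := q) ((hsink _).2 (Or.inl rfl)) hk₂ ?_ ?_ ?_ ?_ ?_ ?_
        (Or.inr ⟨rfl, hweight ((hE _ _).2 (by omega)) hm⟩) h
      all_goals simp only [Set.mem_ofPred_eq, ne_eq, ← hinj.eq_iff, hadd]
      · intro x hx y hy
        have := (hE x y).1 hy
        omega
      · intro x hx hxk y hy
        have := (hE x y).1 hy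
        have := hlt x
        omega
      · omega
      · omega
      · intro j
        have := hlt j
        split_ifs <;> omega
      · intro j
        have := hlt j
        split_ifs <;> omega
    · obtain ⟨p, hp⟩ := hex (κ + 1) (by omega)
      refine fundamentalCycle_not_mem_boundaries (P := {x | κ < pos x ∧ pos x ≤ a'}) (p := p)
        (q := s₂) ((hsink _).2 (Or.inr rfl)) hk₂ ?_ ?_ ?_ ?_ ?_ ?_
        (Or.inl ⟨rfl, hweight ((hE _ _).2 (by omega)) hm⟩) h
      all_goals simp only [Set.mem_ofPred_eq, ne_eq, ← hinj.eq_iff, hadd]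
      · intro x hx y hy
        have := (hE x y).1 hy
        omega
      · intro x hx hxk y hy
        have := (hE x y).1 hy
        have := hlt x
        omega
      · omega
      · omega
      · intro j
        have := hlt j
        split_ifs <;> omega
      · intro j
        have := hlt j
        split_ifs <;> omega
  · intro hnot
    refine subsingleton_homology_one fun c hc => ?_
    obtain ⟨r, hr, hr0⟩ := exists_smul_fundamentalCycle hcycle hρ hc
    by_cases hm : maxEdgeWeight ω ≤ δ
    · have hM := not_lt.1 fun h => hnot ⟨hm, h⟩
      simp only [max_le_iff] at hM
      obtain ⟨⟨h₁₁, h₁₂⟩, h₂₁, h₂₂⟩ := hM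
      suffices hz : fundamentalCycle n ∈ boundaries (dowkerComplex ω δ) 1 by
        have := add_mem hr (Submodule.smul_mem _ r hz)
        rwa [sub_add_cancel] at this
      rcases eq_or_ne δ ∞ with rfl | hδ
      · exact fundamentalCycle_mem_boundaries_top
      have hreach : ∀ {k x}, pathDist ω k x ≤ δ → Reaches ω k x := fun hx =>
        pathDist_lt_top_iff.1 (hx.trans_lt (lt_top_iff_ne_top.2 hδ))
      -- The two arcs leaving `k₁` end at different sinks, so predecessors within their union are
      -- unique.
      have hfin₁ : ∀ {x}, Reaches ω k₁ x → pathDist ω k₁ x ≤ δ := by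
        refine fun hx => pathDist_le_of_sinks hρn hρ hk₁ ?_ ?_ hx
        · intro x y z hx hy hxz hyz
          have := hR₁ x hx
          have := hR₁ y hy
          have := hlt x
          have := hlt y
          have := (hE x z).1 hxz
          have := (hE y z).1 hyz
          exact hinj (by omega)
        · intro s hs
          rcases (hsink s).1 hs with rfl | rfl
          · exact h₁₁
          · exact h₁₂
      have hfin₂ : ∀ {x}, Reaches ω k₂ x → pathDist ω k₂ x ≤ δ := by
        refine fun hx => pathDist_le_of_sinks hρn hρ hk₂ ?_ ?_ hx
        · intro x y z hx hy hxz hyz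
          have := hR₂ x hx
          have := hR₂ y hy
          have := (hE x z).1 hxz
          have := (hE y z).1 hyz
          exact hinj (by omega)
        · intro s hs
          rcases (hsink s).1 hs with rfl | rfl
          · exact h₂₁
          · exact h₂₂
      refine fundamentalCycle_mem_boundaries_of_two h₁₁ h₁₂ h₂₁ h₂₂ ?_ ?_
      · intro x h1 h2
        have := hR₁ x (hreach h1)
        have := hR₂ x (hreach h2)
        rw [← hinj.eq_iff, ← hinj.eq_iff]
        omega
      · intro i
        -- A source reaching the tail of an edge also reaches its head, and so sees both.
        rcases (hcycle.finite_iff i (i + 1)).2 (Or.inl rfl) with h | h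
        · exact (hdom i).imp (fun hi => ⟨hfin₁ hi, hfin₁ (hi.tail h)⟩)
            (fun hi => ⟨hfin₂ hi, hfin₂ (hi.tail h)⟩)
        · exact (hdom (i + 1)).imp (fun hi => ⟨hfin₁ (hi.tail h), hfin₁ hi⟩)
            (fun hi => ⟨hfin₂ (hi.tail h), hfin₂ hi⟩)
    · simp only [maxEdgeWeight, iSup_le_iff, not_forall, not_le] at hm
      obtain ⟨i, hi⟩ := hm
      rwa [hr0 i hi, zero_smul, sub_zero] at hr
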